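/- Let $s\in(0,1)$ and $n\in\mathbb N$ with $n>2s$, and put $2^*_s:=\frac{2n}{n-2s}$. Let $\dot H^s(\mathbb R^n)$ be the space of functions $u\in L^{2^*_s}(\mathbb R^n)$ with $$\iint_{\mathbb R^{2n}}\frac{|u(x)-u(y)|^2}{|x-y|^{n+2s}}\,dx\,dy<+\infty ,$$ and let $X^s:=\dot H^s(\mathbb R^n)\cap L^\infty(\mathbb R^n)$. For a measurable $F:\mathbb R^n\to\mathbb R$, a function $u\in\dot H^s(\mathbb R^n)$ is called a weak solution of $(-\Delta)^su=F$ in $\mathbb R^n$ if $$\iint_{\mathbb R^{2n}}\frac{(u(x)-u(y))(\varphi(x)-\varphi(y))}{|x-y|^{n+2s}}\,dx\,dy=\int_{\mathbb R^n}F\varphi\,dx$$ for every $\varphi\in X^s$ such that $F\varphi$ is integrable (if $F\in L^{2n/(n+2s)}(\mathbb R^n)$, this means every $\varphi\in X^s$). **Theorem.** Let $K\in\mathbb N$ and, for $i=1,\dots,K$, let $\gamma_i\in[0,2^*_s-1)$ and $m_i\in(\underline m_i,+\infty]$, where $$\underline m_i:=\begin{cases}\dfrac{2^*_s}{2^*_s-2}&\text{if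 }\gamma_i\in[0,1],\\[2mm]\dfrac{2^*_s}{2^*_s-1-\gamma_i}&\text{if }\gamma_i\in(1,2^*_s-1).\end{cases}$$ Let $f,f_1,\dots,f_K:\mathbb R^n\times\mathbb R\to\mathbb R$ and $h_i\in L^{m_i}(\mathbb R^n,[0,+\infty))$ be such that, for a.e. $x\in\mathbb R^n$ and all $r\in\mathbb R$, $$|f(x,r)|\le\sum_{i=1}^Kf_i(x,r)\qquad\text{and}\qquad f_i(x,r)\le h_i(x)\,|r|^{\gamma_i}\quad(i=1,\dots,K),$$ with the convention $|r|^0=1$. Let $u\in\dot H^s(\mathbb R^n)$ be a weak solution of $(-\Delta)^su=f(x,u(x))$ in $\mathbb R^n$, where $x\mapsto f(x,u(x))$ is measurable. Then $$\|u\|_{L^\infty(\mathbb R^n)}\le C,$$ where $C>0$ depends only on $n$, $s$, $K$, $\|u\|_{L^{2^*_s}(\mathbb R^n)}$, and the $\gamma_i$, $m_i$ and $\|h_i\|_{L^{m_i}(\mathbb R^n)}$, $i=1,\dots,K$. -/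

import Mathlib

open MeasureTheory Set
open scoped ENNReal NNReal

namespace FracElliptic

/-- The fractional critical exponent `2*_s = 2n / (n - 2s)` (used for `2s < n` only). -/
noncomputable def critExp (n : ℕ) (s : ℝ) : ℝ := 2 * (n : ℝ) / ((n : ℝ) - 2 * s)

/-- The squared Gagliardo seminorm `∬ |u(x) - u(y)|² / |x - y|^(n + 2s) dx dy`,
with values in `[0, ∞]`. -/
noncomputable def gagliardoSq {n : ℕ} (s : ℝ) (u : EuclideanSpace ℝ (Fin n) → ℝ) : ℝ≥0∞ :=
  ∫⁻ p : EuclideanSpace ℝ (Fin n) × EuclideanSpace ℝ (Fin n),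
    ENNReal.ofReal (|u p.1 - u p.2| ^ 2 / ‖p.1 - p.2‖ ^ ((n : ℝ) + 2 * s))

/-- The bilinear form `∬ (u(x) - u(y)) (φ(x) - φ(y)) / |x - y|^(n + 2s) dx dy`. If both functions
have finite Gagliardo seminorm then the integrand is absolutely integrable (Cauchy-Schwarz). -/
noncomputable def gagliardoForm {n : ℕ} (s : ℝ) (u φ : EuclideanSpace ℝ (Fin n) → ℝ) : ℝ :=
  ∫ p : EuclideanSpace ℝ (Fin n) × EuclideanSpace ℝ (Fin n),
    (u p.1 - u p.2) * (φ p.1 - φ p.2) / ‖p.1 - p.2‖ ^ ((n : ℝ) + 2 * s)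

/-- The homogeneous space `Ḣ^s(ℝⁿ)`: the functions in `L^{2*_s}(ℝⁿ)` with finite
Gagliardo seminorm. -/
structure MemHDot {n : ℕ} (s : ℝ) (u : EuclideanSpace ℝ (Fin n) → ℝ) : Prop where
  memLp : MemLp u (ENNReal.ofReal (critExp n s)) volume
  gagliardoSq_lt_top : gagliardoSq s u < ∞

/-- The space `X^s = Ḣ^s(ℝⁿ) ∩ L^∞(ℝⁿ)` of test functions. -/
structure MemX {n : ℕ} (s : ℝ) (φ : EuclideanSpace ℝ (Fin n) → ℝ) : Prop where
  memHDot : MemHDot s φ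
  memLp_top : MemLp φ ∞ volume

/-- `u ∈ Ḣ^s(ℝⁿ)` is a weak solution of `(-Δ)^s u = F` in `ℝⁿ`, for a measurable right-hand
side `F`: the weak formulation holds for each test function `φ ∈ X^s` for which its right-hand
side is an absolutely convergent integral. If `F` belongs to `L^{2n/(n+2s)}(ℝⁿ)`, the dual
of `L^{2*_s}(ℝⁿ)`, then every `φ ∈ X^s` is such a test function, by Hölder's inequality. -/
structure IsWeakSolution {n : ℕ} (s : ℝ) (u F : EuclideanSpace ℝ (Fin n) → ℝ) : Prop where
  memHDot : MemHDot s u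
  aestronglyMeasurable : AEStronglyMeasurable F volume
  weak_eq : ∀ φ : EuclideanSpace ℝ (Fin n) → ℝ, MemX s φ →
    Integrable (fun x => F x * φ x) volume →
    gagliardoForm s u φ = ∫ x, F x * φ x

/-- The threshold for the integrability exponent of a coefficient of growth `|r|^γ`:
`2*_s / (2*_s - 2)` if `γ ≤ 1` and `2*_s / (2*_s - 1 - γ)` if `1 < γ`. -/
noncomputable def mLower (n : ℕ) (s γ : ℝ) : ℝ :=
  if γ ≤ 1 then critExp n s / (critExp n s - 2) else critExp n s / (critExp n s - 1 - γ)

end FracElliptic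

/-!
The bound is obtained by the level set method of De Giorgi and Stampacchia, applied to `u` and `-u`.
Write `a(k) = |{u > k}|` and `σ = 2s/n = 1 - 2/p`, where `p = 2*_s`.

For `1 ≤ k < l` the slice `T = min ((u - k)⁺, l - k)` is a bounded test function. As `T` is a monotone
1-Lipschitz function of `u`, the weak formulation bounds its Gagliardo energy by
`(l - k) ∫_{u > k} |f(x, u)|` (`IsWeakSolution.gagliardoSq_levelSlice_le`). On the other hand, the
interaction between `{u > l}` and the complement of `{u > k}` alone makes this energy at least
`c (l - k)² a(l) a(k) ^ (-σ)` (`exists_measure_superlevel_le_gagliardoSq`); this elementary inequality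
takes the place of the fractional Sobolev inequality. On `{u > k}` one has `|u| ^ γ ≤ |u| ^ max γ 1`, so
with Hölder's inequality and `θᵢ = 1/mᵢ` the result is the level set inequality `LevelDecay`:
`(l - k) a(l) ≤ A a(k) ^ σ ∑ᵢ Hᵢ (∫_{u > k} u ^ (γᵢ / (1 - θᵢ))) ^ (1 - θᵢ)`.

The rest concerns this inequality only (`LevelDecay.exists_forall_ae_le`). The thresholds for the
`mᵢ` say that `ε = minᵢ (p (σ - θᵢ) - (γᵢ - 1))` is positive. If `∫_{u > 1} u ^ R` is controlled for some
`R ≥ p`, then Chebyshev's inequality and `l = 2k` give `a(2k) ≲ k ^ (-(R + ε))`, hence control of the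
moment of order `R + ε/2`. So, starting from the norm of `u` in `L^p`, moments of arbitrarily large
order are controlled, and for large order the right-hand side is at most a constant times
`a(k) ^ (1 + δ)` with `δ > 0`. Stampacchia's lemma then shows that `a` vanishes at a level depending on
the data only.
-/

namespace FracElliptic

/-! ### From level set inequalities to boundedness -/

section LevelSets

variable {α : Type*} [MeasurableSpace α] {μ : Measure α} {u : α → ℝ}

/-- The moment `∫ u ^ R` over the superlevel set `{u > k}`. -/
noncomputable def upperMoment (μ : Measure α) (u : α → ℝ) (R k : ℝ) : ℝ≥0∞ :=
  ∫⁻ x in {x | k < u x}, ENNReal.ofReal (u x) ^ R ∂μ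

lemma nullMeasurableSet_superlevel (hu : AEMeasurable u μ) (k : ℝ) :
    NullMeasurableSet {x | k < u x} μ :=
  nullMeasurableSet_lt aemeasurable_const hu

lemma upperMoment_zero (k : ℝ) : upperMoment μ u 0 k = μ {x | k < u x} := by
  simp [upperMoment]

lemma upperMoment_anti {k l : ℝ} (R : ℝ) (hkl : k ≤ l) :
    upperMoment μ u R l ≤ upperMoment μ u R k :=
  lintegral_mono_set fun _ hx => lt_of_le_of_lt hkl hx

/-- Chebyshev's inequality for moments of different order. -/
lemma upperMoment_le_rpow_mul (hu : AEMeasurable u μ) {q R k : ℝ} (hk : 1 ≤ k) (hqR : q ≤ R) :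
    upperMoment μ u q k ≤ ENNReal.ofReal (k ^ (q - R)) * upperMoment μ u R 1 := by
  have hk0 : 0 < k := by linarith
  refine le_trans ?_ (mul_le_mul_right (upperMoment_anti R hk) _)
  unfold upperMoment
  rw [← lintegral_const_mul' _ _ ENNReal.ofReal_ne_top]
  refine lintegral_mono_ae ?_
  filter_upwards [ae_restrict_mem₀ (nullMeasurableSet_superlevel hu k)] with x hx
  have hx : k < u x := hx
  have hux : 0 < u x := by linarith
  rw [ENNReal.ofReal_rpow_of_pos hux, ENNReal.ofReal_rpow_of_pos hux,
    ← ENNReal.ofReal_mul (by positivity)]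
  refine ENNReal.ofReal_le_ofReal ?_
  calc u x ^ q = u x ^ (q - R) * u x ^ R := by rw [← Real.rpow_add hux]; ring_nf
    _ ≤ k ^ (q - R) * u x ^ R := by
      exact mul_le_mul_of_nonneg_right
        (Real.rpow_le_rpow_of_nonpos hk0 hx.le (by linarith)) (by positivity)

/-- Polynomial decay of the distribution function at the dyadic levels controls every moment of
smaller order. -/
lemma upperMoment_le_of_dyadic_decay (hu : AEMeasurable u μ) {q r : ℝ} (hq : 0 ≤ q) (D : ℝ≥0)
    (h : ∀ j : ℕ, μ {x | (2 : ℝ) ^ j < u x} ≤ D * ENNReal.ofReal ((2 : ℝ) ^ (-r)) ^ j) :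
    upperMoment μ u q 1 ≤
      ENNReal.ofReal (2 ^ q) * D * (1 - ENNReal.ofReal ((2 : ℝ) ^ (q - r)))⁻¹ := by
  have hpt : upperMoment μ u q 1 ≤ ∫⁻ x, ∑' j : ℕ, ENNReal.ofReal (2 ^ q) ^ (j + 1) *
      ({x | (2 : ℝ) ^ j < u x}).indicator 1 x ∂μ := by
    refine le_trans (lintegral_mono_ae ?_) (setLIntegral_le_lintegral {x | 1 < u x} _)
    filter_upwards [ae_restrict_mem₀ (nullMeasurableSet_superlevel hu 1)] with x hx
    have hx : 1 < u x := hx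
    obtain ⟨j, hj1, hj2⟩ := exists_nat_pow_near hx.le one_lt_two
    have hux : 0 < u x := by linarith
    -- `2 ^ j < u x ≤ 2 ^ (j + 1)` for some `j`
    obtain ⟨i, hi1, hi2⟩ : ∃ i : ℕ, (2 : ℝ) ^ i < u x ∧ u x ≤ 2 ^ (i + 1) := by
      rcases hj1.lt_or_eq with h' | h'
      · exact ⟨j, h', hj2.le⟩
      · cases j with
        | zero => simp at h'; linarith
        | succ i => exact ⟨i, by rw [← h']; exact pow_lt_pow_right₀ one_lt_two (by simp), h'.ge⟩
    refine le_trans ?_ (ENNReal.le_tsum i)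
    rw [indicator_of_mem (by exact hi1), Pi.one_apply, mul_one, ENNReal.ofReal_rpow_of_pos hux,
      ← ENNReal.ofReal_pow (by positivity)]
    refine ENNReal.ofReal_le_ofReal ?_
    calc u x ^ q ≤ (2 ^ (i + 1)) ^ q := by gcongr
      _ = (2 ^ q) ^ (i + 1) := by
        rw [← Real.rpow_natCast, ← Real.rpow_natCast, ← Real.rpow_mul two_pos.le,
          ← Real.rpow_mul two_pos.le, mul_comm]
  refine hpt.trans ?_
  rw [lintegral_tsum fun j => by
    refine AEMeasurable.const_mul ?_ _
    exact (aemeasurable_const (b := (1 : ℝ≥0∞))).indicator₀ (nullMeasurableSet_superlevel hu _)]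
  rw [← ENNReal.tsum_geometric, ← ENNReal.tsum_mul_left]
  refine ENNReal.tsum_le_tsum fun j => ?_
  rw [lintegral_const_mul' _ _ (by finiteness), lintegral_indicator_one₀
    (nullMeasurableSet_superlevel hu _)]
  refine (mul_le_mul_right (h j) _).trans (le_of_eq ?_)
  have : ENNReal.ofReal ((2 : ℝ) ^ (q - r)) =
      ENNReal.ofReal (2 ^ q) * ENNReal.ofReal ((2 : ℝ) ^ (-r)) := by
    rw [← ENNReal.ofReal_mul (by positivity), ← Real.rpow_add two_pos, sub_eq_add_neg]
  rw [this, mul_pow, pow_succ]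
  ring

/-- Hölder's inequality for moments over a superlevel set. -/
lemma upperMoment_le_interpolate (hu : AEMeasurable u μ) {q R k : ℝ} (hk : 1 ≤ k) (hq : 0 < q)
    (hqR : q < R) :
    upperMoment μ u q k ≤ upperMoment μ u R 1 ^ (q / R) * μ {x | k < u x} ^ (1 - q / R) := by
  have hR : 0 < R := hq.trans hqR
  have hlt : q / R < 1 := (div_lt_one hR).2 hqR
  have hpos : 0 < q / R := by positivity
  have hconj : (R / q).HolderConjugate (1 - q / R)⁻¹ := by
    rw [Real.holderConjugate_iff]
    refine ⟨(one_lt_div hq).2 hqR, ?_⟩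
    rw [inv_inv, inv_div]; ring
  have := ENNReal.lintegral_mul_le_Lp_mul_Lq (μ.restrict {x | k < u x}) hconj
    (f := fun x => ENNReal.ofReal (u x) ^ q) (g := fun _ => 1)
    ((hu.ennreal_ofReal.restrict).pow_const q) aemeasurable_const
  simp only [Pi.mul_apply, mul_one, one_div, inv_div, inv_inv, ENNReal.one_rpow, lintegral_one,
    Measure.restrict_apply_univ, ← ENNReal.rpow_mul] at this
  rw [mul_div_cancel₀ _ hq.ne'] at this
  refine this.trans ?_
  gcongr
  exact upperMoment_anti R hk

/-- The level set inequality satisfied by solutions: the measure of `{u > l}` is controlled by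
the measure of the larger set `{u > k}` and moments of `u` over it. The exponent `σ` measures the
gain from the Gagliardo energy; `H i`, `θ i` and `γ i` stand for the norm, the reciprocal
integrability exponent and the growth exponent of the coefficients of the equation. -/
def LevelDecay (μ : Measure α) (u : α → ℝ) (σ : ℝ) (A : ℝ≥0) {K : ℕ} (γ θ : Fin K → ℝ)
    (H : Fin K → ℝ≥0) : Prop :=
  ∀ k l : ℝ, 1 ≤ k → k < l →
    ENNReal.ofReal (l - k) * μ {x | l < u x} ≤ A * μ {x | k < u x} ^ σ *
      ∑ i, H i * upperMoment μ u (γ i / (1 - θ i)) k ^ (1 - θ i)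

variable {σ : ℝ} {A : ℝ≥0} {K : ℕ} {γ θ : Fin K → ℝ} {H : Fin K → ℝ≥0}

/-- A bound on the moment of order `R` improves to one of order `R + ε / 2`. The hypothesis `hε`
says that the coefficients are subcritical at order `p`, hence at all larger orders `R`. -/
lemma LevelDecay.exists_upperMoment_le_add (μ : Measure α) (A : ℝ≥0) (H : Fin K → ℝ≥0)
    {p R ε : ℝ} (hσ : 0 ≤ σ) (hp : 0 < p) (hpR : p ≤ R) (hε : 0 < ε)
    (hθ : ∀ i, θ i < 1) (hθσ : ∀ i, θ i ≤ σ)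
    (hγp : ∀ i, γ i ≤ p * (1 - θ i)) (hεi : ∀ i, ε ≤ p * (σ - θ i) - (γ i - 1)) (M : ℝ≥0) :
    ∃ M' : ℝ≥0, ∀ u : α → ℝ, AEMeasurable u μ → LevelDecay μ u σ A γ θ H →
      upperMoment μ u R 1 ≤ M → upperMoment μ u (R + ε / 2) 1 ≤ M' := by
  have hR : 0 < R := hp.trans_le hpR
  set S : ℝ≥0∞ := A * (M : ℝ≥0∞) ^ σ * ∑ i, H i * (M : ℝ≥0∞) ^ (1 - θ i) with hS
  have hStop : S ≠ ∞ := by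
    refine ENNReal.mul_ne_top (ENNReal.mul_ne_top ENNReal.coe_ne_top
      (ENNReal.rpow_ne_top_of_nonneg hσ ENNReal.coe_ne_top)) ?_
    refine ENNReal.sum_ne_top.2 fun i _ => ENNReal.mul_ne_top ENNReal.coe_ne_top
      (ENNReal.rpow_ne_top_of_nonneg (by linarith [hθ i]) ENNReal.coe_ne_top)
  set D : ℝ≥0 := M + S.toNNReal * Real.toNNReal (2 ^ (R + ε)) with hD
  refine ⟨(ENNReal.ofReal (2 ^ (R + ε / 2)) * D *
    (1 - ENNReal.ofReal ((2 : ℝ) ^ (R + ε / 2 - (R + ε))))⁻¹).toNNReal, fun u hu hdec hM => ?_⟩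
  have hlt : (2 : ℝ) ^ (R + ε / 2 - (R + ε)) < 1 :=
    Real.rpow_lt_one_of_one_lt_of_neg one_lt_two (by linarith)
  rw [ENNReal.coe_toNNReal]
  swap
  · refine ENNReal.mul_ne_top (by finiteness) (ENNReal.inv_ne_top.2 ?_)
    rw [Ne, tsub_eq_zero_iff_le, not_le]
    exact ENNReal.ofReal_lt_one.2 hlt
  have cheb : ∀ k q : ℝ, 1 ≤ k → q ≤ R →
      upperMoment μ u q k ≤ ENNReal.ofReal (k ^ (q - R)) * M := fun k q hk hq =>
    (upperMoment_le_rpow_mul hu hk hq).trans (mul_le_mul_right hM _)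
  have key : ∀ k : ℝ, 1 ≤ k → μ {x | 2 * k < u x} ≤ S * ENNReal.ofReal (k ^ (-(R + ε))) := by
    intro k hk
    have hk0 : 0 < k := by linarith
    have h1 := hdec k (2 * k) hk (by linarith)
    rw [two_mul, add_sub_cancel_right, ← two_mul] at h1
    have h2 : μ {x | k < u x} ^ σ ≤ ENNReal.ofReal (k ^ (-(R * σ))) * (M : ℝ≥0∞) ^ σ := by
      rw [← upperMoment_zero]
      refine (ENNReal.rpow_le_rpow (cheb k 0 hk hR.le) hσ).trans (le_of_eq ?_)
      rw [ENNReal.mul_rpow_of_nonneg _ _ hσ, ENNReal.ofReal_rpow_of_pos (by positivity),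
        ← Real.rpow_mul hk0.le]
      ring_nf
    have h3 : ∀ i, upperMoment μ u (γ i / (1 - θ i)) k ^ (1 - θ i) ≤
        ENNReal.ofReal (k ^ (R * σ - (R + ε) + 1)) * (M : ℝ≥0∞) ^ (1 - θ i) := by
      intro i
      have hi : 0 < 1 - θ i := by linarith [hθ i]
      have hq : γ i / (1 - θ i) ≤ R := by
        rw [div_le_iff₀ hi]
        exact (hγp i).trans (by gcongr)
      refine (ENNReal.rpow_le_rpow (cheb k _ hk hq) hi.le).trans ?_
      rw [ENNReal.mul_rpow_of_nonneg _ _ hi.le, ENNReal.ofReal_rpow_of_pos (by positivity),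
        ← Real.rpow_mul hk0.le]
      refine mul_le_mul_left (ENNReal.ofReal_le_ofReal
        (Real.rpow_le_rpow_of_exponent_le hk ?_)) _
      · rw [sub_mul, div_mul_cancel₀ _ hi.ne']
        nlinarith [hεi i, mul_le_mul_of_nonneg_right hpR (sub_nonneg.2 (hθσ i))]
    have hk' : ENNReal.ofReal k ≠ 0 := by simpa using hk0
    rw [← ENNReal.mul_le_mul_iff_right hk' ENNReal.ofReal_ne_top]
    refine h1.trans ?_
    calc (A : ℝ≥0∞) * μ {x | k < u x} ^ σ *
          ∑ i, H i * upperMoment μ u (γ i / (1 - θ i)) k ^ (1 - θ i)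
        ≤ A * (ENNReal.ofReal (k ^ (-(R * σ))) * (M : ℝ≥0∞) ^ σ) *
          ∑ i, H i * (ENNReal.ofReal (k ^ (R * σ - (R + ε) + 1)) * (M : ℝ≥0∞) ^ (1 - θ i)) := by
          gcongr with i _
          exact h3 i
      _ = (ENNReal.ofReal (k ^ (-(R * σ))) * ENNReal.ofReal (k ^ (R * σ - (R + ε) + 1))) * S := by
          rw [hS]
          simp_rw [mul_left_comm (H _ : ℝ≥0∞) (ENNReal.ofReal _), ← Finset.mul_sum]
          ring
      _ = _ := by
          rw [mul_left_comm (ENNReal.ofReal k), mul_comm _ S, ← ENNReal.ofReal_mul (by positivity),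
            ← ENNReal.ofReal_mul hk0.le]
          congr 2
          nth_rewrite 3 [← Real.rpow_one k]
          rw [← Real.rpow_add hk0, ← Real.rpow_add hk0]
          ring_nf
  refine upperMoment_le_of_dyadic_decay hu (by linarith) D fun j => ?_
  cases j with
  | zero =>
    simp only [pow_zero, mul_one]
    have := cheb 1 0 le_rfl hR.le
    rw [upperMoment_zero, Real.one_rpow, ENNReal.ofReal_one, one_mul] at this
    exact this.trans (by simp [hD])
  | succ j =>
    have h1 := key (2 ^ j) (one_le_pow₀ one_le_two)
    rw [← pow_succ'] at h1
    refine h1.trans ?_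
    have : ENNReal.ofReal (((2 : ℝ) ^ j) ^ (-(R + ε))) = ENNReal.ofReal (2 ^ (R + ε)) *
        ENNReal.ofReal ((2 : ℝ) ^ (-(R + ε))) ^ (j + 1) := by
      rw [← ENNReal.ofReal_pow (by positivity), ← ENNReal.ofReal_mul (by positivity)]
      congr 1
      rw [← Real.rpow_natCast, ← Real.rpow_natCast, ← Real.rpow_mul two_pos.le,
        ← Real.rpow_mul two_pos.le, ← Real.rpow_add two_pos]
      congr 1
      push_cast
      ring
    rw [this, ← mul_assoc]
    gcongr
    rw [hD]
    push_cast
    rw [ENNReal.coe_toNNReal hStop]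
    exact le_add_self

/-- Iterating the improvement gives bounds for moments of arbitrarily large order. -/
lemma LevelDecay.exists_upperMoment_le (μ : Measure α) (A : ℝ≥0) (H : Fin K → ℝ≥0)
    {p ε : ℝ} (hσ : 0 ≤ σ) (hp : 0 < p) (hε : 0 < ε)
    (hθ : ∀ i, θ i < 1) (hθσ : ∀ i, θ i ≤ σ)
    (hγp : ∀ i, γ i ≤ p * (1 - θ i)) (hεi : ∀ i, ε ≤ p * (σ - θ i) - (γ i - 1)) (M : ℝ≥0)
    (N : ℕ) :
    ∃ M' : ℝ≥0, ∀ u : α → ℝ, AEMeasurable u μ → LevelDecay μ u σ A γ θ H →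
      upperMoment μ u p 1 ≤ M → upperMoment μ u (p + N * (ε / 2)) 1 ≤ M' := by
  induction N with
  | zero => exact ⟨M, fun u _ _ h => by simpa using h⟩
  | succ N ih =>
    obtain ⟨M₁, h₁⟩ := ih
    obtain ⟨M₂, h₂⟩ := LevelDecay.exists_upperMoment_le_add μ A H (R := p + N * (ε / 2)) hσ hp
      (by simp only [le_add_iff_nonneg_right]; positivity) hε hθ hθσ hγp hεi M₁
    refine ⟨M₂, fun u hu hd h => ?_⟩
    have := h₂ u hu hd (h₁ u hu hd h)
    rw [add_assoc] at this
    convert this using 2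
    push_cast
    ring

/-- Stampacchia's lemma: along the levels `k₀ + d (1 - 2⁻ʲ)` the function decays geometrically in
`j`, where `d` is chosen so that the superlinear power absorbs the shrinking gaps. -/
lemma eq_zero_of_stampacchia {a : ℝ → ℝ} (ha : Antitone a) (ha0 : ∀ t, 0 ≤ a t) {k₀ D δ : ℝ}
    (hD : 0 < D) (hδ : 0 < δ) (h1 : a k₀ ≤ 1)
    (h : ∀ k l, k₀ ≤ k → k < l → (l - k) * a l ≤ D * a k ^ (1 + δ)) :
    a (k₀ + 2 * D * 2 ^ (1 / δ)) = 0 := by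
  set d : ℝ := 2 * D * 2 ^ (1 / δ) with hd
  have hd0 : 0 < d := by positivity
  have hq0 : (0 : ℝ) < 2 ^ (-(1 / δ)) := by positivity
  have hq1 : (2 : ℝ) ^ (-(1 / δ)) < 1 :=
    Real.rpow_lt_one_of_one_lt_of_neg one_lt_two (by simpa using hδ)
  set q : ℝ := 2 ^ (-(1 / δ)) with hq
  have hqδ : q ^ (1 + δ) = q * (1 / 2) := by
    rw [Real.rpow_add hq0, Real.rpow_one, hq, ← Real.rpow_mul two_pos.le, neg_mul,
      one_div_mul_cancel hδ.ne', Real.rpow_neg_one]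
    norm_num
  have step : ∀ j : ℕ, a (k₀ + d * (1 - (1 / 2) ^ j)) ≤ q ^ j := by
    intro j
    induction j with
    | zero => simpa using h1
    | succ j ih =>
      have hp : (0 : ℝ) < (1 / 2) ^ j := by positivity
      have hp1 : ((1 : ℝ) / 2) ^ j ≤ 1 := pow_le_one₀ (by norm_num) (by norm_num)
      have h2 := h (k₀ + d * (1 - (1 / 2) ^ j)) (k₀ + d * (1 - (1 / 2) ^ (j + 1)))
        (by nlinarith) (by rw [pow_succ]; nlinarith [mul_pos hd0 hp])
      have h3 : a (k₀ + d * (1 - (1 / 2) ^ j)) ^ (1 + δ) ≤ q ^ j * (1 / 2) ^ j := by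
        calc _ ≤ (q ^ j) ^ (1 + δ) := by
              exact Real.rpow_le_rpow (ha0 _) ih (by linarith)
          _ = (q ^ (1 + δ)) ^ j := by
              rw [← Real.rpow_natCast, ← Real.rpow_natCast, ← Real.rpow_mul hq0.le,
                ← Real.rpow_mul hq0.le, mul_comm]
          _ = _ := by rw [hqδ, mul_pow]
      have h4 : d * (1 / 2) ^ j * (1 / 2) * a (k₀ + d * (1 - (1 / 2) ^ (j + 1))) ≤
          D * (q ^ j * (1 / 2) ^ j) := by
        refine le_trans (le_of_eq ?_) (h2.trans (by gcongr))
        rw [pow_succ]; ring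
      have h5 : D = d * (1 / 2) * q := by
        have : (2 : ℝ) ^ (1 / δ) * q = 1 := by
          rw [hq, ← Real.rpow_add two_pos]; simp
        calc D = D * ((2 : ℝ) ^ (1 / δ) * q) := by rw [this, mul_one]
          _ = _ := by rw [hd]; ring
      have h6 : 0 < d * (1 / 2) ^ j * (1 / 2) := by positivity
      refine le_of_mul_le_mul_left (h4.trans (le_of_eq ?_)) h6
      nth_rewrite 1 [h5]
      rw [pow_succ]; ring
  refine le_antisymm ?_ (ha0 _)
  refine ge_of_tendsto' (tendsto_pow_atTop_nhds_zero_of_lt_one hq0.le hq1) fun j => ?_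
  refine le_trans (ha ?_) (step j)
  have hp : (0 : ℝ) < (1 / 2) ^ j := by positivity
  nlinarith

/-- Functions obeying a subcritical level set inequality are bounded above, in terms of the data
and a moment of order `p` only. -/
theorem LevelDecay.exists_forall_ae_le (μ : Measure α) (A : ℝ≥0) (H : Fin K → ℝ≥0)
    {p : ℝ} (hp : 1 ≤ p) (hσ : 0 ≤ σ) (hσ1 : σ ≤ 1)
    (hθ : ∀ i, θ i < 1) (hγ : ∀ i, 1 ≤ γ i)
    (hγp : ∀ i, γ i ≤ p * (1 - θ i)) (hsub : ∀ i, γ i - 1 < p * (σ - θ i)) (M : ℝ≥0) :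
    ∃ C : ℝ, 0 < C ∧ ∀ u : α → ℝ, AEMeasurable u μ → LevelDecay μ u σ A γ θ H →
      upperMoment μ u p 1 ≤ M → ∀ᵐ x ∂μ, u x ≤ C := by
  have hp0 : 0 < p := by linarith
  have hθσ : ∀ i, 0 < σ - θ i := fun i =>
    pos_of_mul_pos_right ((sub_nonneg.2 (hγ i)).trans_lt (hsub i)) hp0.le
  -- a uniform gain over the finitely many coefficients
  have hmin : ∀ g : Fin K → ℝ, (∀ i, 0 < g i) → ∃ ε, 0 < ε ∧ ∀ i, ε ≤ g i := by
    intro g hg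
    have : ∀ᶠ ε in nhdsWithin (0 : ℝ) (Ioi 0), ∀ i, ε ≤ g i :=
      Filter.eventually_all.2 fun i => nhdsWithin_le_nhds (Iic_mem_nhds (hg i))
    obtain ⟨ε, h1, h2⟩ := (this.and self_mem_nhdsWithin).exists
    exact ⟨ε, h2, h1⟩
  obtain ⟨ε, hε, hεi⟩ := hmin (fun i => p * (σ - θ i) - (γ i - 1)) fun i => by linarith [hsub i]
  obtain ⟨δ, hδ, hδi⟩ := hmin (fun i => (σ - θ i) / 2) fun i => by linarith [hθσ i]
  -- an order `R` so large that the loss `γ i / R` is at most half of the gain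
  obtain ⟨N, hN⟩ : ∃ N : ℕ, ∀ i, γ i / (p + N * (ε / 2)) ≤ δ := by
    have h1 : Filter.Tendsto (fun N : ℕ => p + (N : ℝ) * (ε / 2)) Filter.atTop Filter.atTop :=
      Filter.tendsto_atTop_add_const_left _ _
        (tendsto_natCast_atTop_atTop.atTop_mul_const (by positivity))
    have h2 := (Filter.eventually_all (ι := Fin K)).2 fun i =>
      (h1.const_div_atTop (γ i)).eventually_le_const hδ
    exact h2.exists
  set R : ℝ := p + N * (ε / 2) with hR
  have hR1 : 1 ≤ R := hp.trans (by rw [hR]; simp only [le_add_iff_nonneg_right]; positivity)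
  have hR0 : 0 < R := by linarith
  obtain ⟨M', hM'⟩ := LevelDecay.exists_upperMoment_le μ A H hσ hp0 hε hθ
    (fun i => by linarith [hθσ i]) hγp hεi M N
  -- above this level the distribution function is at most `1`, so its exponents may be lowered
  set k₀ : ℝ := max 1 M' with hk₀
  have hk₀1 : 1 ≤ k₀ := le_max_left _ _
  set S : ℝ≥0∞ := A * ∑ i, H i * (M' : ℝ≥0∞) ^ (γ i / R) with hS
  have hStop : S ≠ ∞ := by
    refine ENNReal.mul_ne_top ENNReal.coe_ne_top ?_
    refine ENNReal.sum_ne_top.2 fun i _ => ENNReal.mul_ne_top ENNReal.coe_ne_top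
      (ENNReal.rpow_ne_top_of_nonneg (div_nonneg (by linarith [hγ i]) hR0.le) ENNReal.coe_ne_top)
  set D : ℝ := S.toReal + 1 with hD
  have hD0 : 0 < D := by positivity
  refine ⟨k₀ + 2 * D * 2 ^ (1 / δ), by positivity, fun u hu hdec hM => ?_⟩
  have hmom := hM' u hu hdec hM
  have hle1 : ∀ k, k₀ ≤ k → μ {x | k < u x} ≤ 1 := by
    intro k hk
    have hk1 := hk₀1.trans hk
    have hk0 : 0 < k := by linarith
    rw [← upperMoment_zero]
    refine (upperMoment_le_rpow_mul hu hk1 hR0.le).trans ?_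
    refine (mul_le_mul_right hmom _).trans ?_
    rw [← ENNReal.ofReal_coe_nnreal, ← ENNReal.ofReal_mul (by positivity)]
    refine ENNReal.ofReal_le_one.2 ?_
    calc k ^ (0 - R) * (M' : ℝ) ≤ k ^ (-1 : ℝ) * k := by
          exact mul_le_mul (Real.rpow_le_rpow_of_exponent_le hk1 (by linarith))
            ((le_max_right _ _).trans hk) M'.2 (by positivity)
      _ = 1 := by rw [Real.rpow_neg_one, inv_mul_cancel₀ hk0.ne']
  have hfin : ∀ k, k₀ ≤ k → μ {x | k < u x} ≠ ∞ := fun k hk =>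
    ((hle1 k hk).trans_lt ENNReal.one_lt_top).ne
  have hanti : ∀ {k l : ℝ}, k ≤ l → μ {x | l < u x} ≤ μ {x | k < u x} := fun hkl =>
    measure_mono fun _ hx => lt_of_le_of_lt hkl hx
  have hineq : ∀ k l, k₀ ≤ k → k < l →
      (l - k) * (μ {x | l < u x}).toReal ≤ D * (μ {x | k < u x}).toReal ^ (1 + δ) := by
    intro k l hk hkl
    have hk1 := hk₀1.trans hk
    set a := μ {x | k < u x} with ha
    have hterm : ∀ i, a ^ σ * upperMoment μ u (γ i / (1 - θ i)) k ^ (1 - θ i) ≤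
        (M' : ℝ≥0∞) ^ (γ i / R) * a ^ (1 + δ) := by
      intro i
      have hi : 0 < 1 - θ i := by linarith [hθ i]
      have hγi := hγ i
      have hgain : γ i / R ≤ δ := hN i
      have hδ' : δ ≤ (σ - θ i) / 2 := hδi i
      rcases eq_or_ne a 0 with h0 | h0
      · have : upperMoment μ u (γ i / (1 - θ i)) k = 0 := by
          unfold upperMoment
          rw [Measure.restrict_eq_zero.2 h0, lintegral_zero_measure]
        rw [this, ENNReal.zero_rpow_of_pos hi, mul_zero]
        exact zero_le
      have hqR : γ i / (1 - θ i) < R := by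
        rw [div_lt_iff₀ hi, mul_comm, ← div_lt_iff₀ hR0]
        linarith
      have h1 := ENNReal.rpow_le_rpow
        (upperMoment_le_interpolate hu hk1 (div_pos (by linarith) hi) hqR) hi.le
      have e1 : γ i / (1 - θ i) / R * (1 - θ i) = γ i / R := by field_simp
      rw [ENNReal.mul_rpow_of_nonneg _ _ hi.le, ← ENNReal.rpow_mul, ← ENNReal.rpow_mul, e1,
        sub_mul, e1, one_mul] at h1
      calc a ^ σ * upperMoment μ u (γ i / (1 - θ i)) k ^ (1 - θ i)
          ≤ a ^ σ * ((M' : ℝ≥0∞) ^ (γ i / R) * a ^ (1 - θ i - γ i / R)) := by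
            gcongr
            refine h1.trans ?_
            gcongr
        _ = (M' : ℝ≥0∞) ^ (γ i / R) * a ^ (σ + (1 - θ i - γ i / R)) := by
            rw [ENNReal.rpow_add _ _ h0 (hfin k hk)]; ring
        _ ≤ _ := by
            refine mul_le_mul_right ?_ _
            exact ENNReal.rpow_le_rpow_of_exponent_ge (hle1 k hk) (by linarith)
    have h1 := hdec k l hk1 hkl
    have h2 : ENNReal.ofReal (l - k) * μ {x | l < u x} ≤ S * a ^ (1 + δ) := by
      refine h1.trans ?_
      rw [hS, mul_assoc, mul_assoc, Finset.mul_sum, Finset.sum_mul]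
      refine mul_le_mul_right (Finset.sum_le_sum fun i _ => ?_) _
      rw [mul_left_comm, mul_assoc]
      exact mul_le_mul_right (hterm i) _
    have h3 := ENNReal.toReal_mono (ENNReal.mul_ne_top hStop
      (ENNReal.rpow_ne_top_of_nonneg (by linarith) (hfin k hk))) h2
    rw [ENNReal.toReal_mul, ENNReal.toReal_mul, ENNReal.toReal_ofReal (by linarith),
      ← ENNReal.toReal_rpow] at h3
    refine h3.trans ?_
    gcongr
    linarith
  -- the distribution function, frozen below the level `k₀` where it might be infinite
  have hzero := eq_zero_of_stampacchia (a := fun t => (μ {x | max k₀ t < u x}).toReal) (k₀ := k₀)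
    (fun s t hst => ENNReal.toReal_mono (hfin _ (le_max_left _ _))
      (hanti (max_le_max le_rfl hst))) (fun _ => ENNReal.toReal_nonneg) hD0 hδ
    (by
      simp only [max_self]
      exact ENNReal.toReal_le_of_le_ofReal zero_le_one (by simpa using hle1 k₀ le_rfl))
    (fun k l hk hkl => by
      simpa only [max_eq_right hk, max_eq_right (hk.trans hkl.le)] using hineq k l hk hkl)
  have hmax : k₀ ≤ k₀ + 2 * D * 2 ^ (1 / δ) := by
    simp only [le_add_iff_nonneg_right]; positivity
  simp only [max_eq_right hmax, ENNReal.toReal_eq_zero_iff, hfin _ hmax, or_false] at hzero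
  rw [ae_iff]
  simpa only [not_le] using hzero

end LevelSets

/-! ### Gagliardo energy of slices -/

section Energy

variable {n : ℕ} {s : ℝ}

/-- The tail of the kernel `|x - y| ^ (-(n + 2s))` off a set `E` of finite measure is at least a
constant times `|E| ^ (-2s / n)`: the ball around `x` of measure `2 |E|` has at least half of its
measure outside `E`. -/
lemma exists_one_le_mul_lintegral_compl (hn : 0 < n) (hs : 0 < s) :
    ∃ B : ℝ≥0, ∀ E : Set (EuclideanSpace ℝ (Fin n)), volume E ≠ 0 → volume E ≠ ∞ → ∀ x ∈ E,
      1 ≤ B * volume E ^ (2 * s / n) *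
        ∫⁻ y in Eᶜ, ENNReal.ofReal (1 / ‖x - y‖ ^ ((n : ℝ) + 2 * s)) := by
  have hn' : (0 : ℝ) < n := by exact_mod_cast hn
  set w : ℝ := (volume (Metric.ball (0 : EuclideanSpace ℝ (Fin n)) 1)).toReal with hw
  have hw_top : volume (Metric.ball (0 : EuclideanSpace ℝ (Fin n)) 1) ≠ ∞ :=
    measure_ball_lt_top.ne
  have hw0 : 0 < w := ENNReal.toReal_pos (Metric.measure_ball_pos _ _ one_pos).ne' hw_top
  set σ : ℝ := 2 * s / n with hσ
  have hσ0 : 0 < σ := by positivity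
  refine ⟨Real.toNNReal ((2 / w) ^ (1 + σ)), fun E hE0 hEtop x hxE => ?_⟩
  set e : ℝ := (volume E).toReal with he
  have he0 : 0 < e := ENNReal.toReal_pos hE0 hEtop
  have hEe : volume E = ENNReal.ofReal e := (ENNReal.ofReal_toReal hEtop).symm
  set R : ℝ := (2 * e / w) ^ (1 / (n : ℝ)) with hR
  have hR0 : 0 < R := by positivity
  have hRn : R ^ n = 2 * e / w := by
    rw [hR, ← Real.rpow_natCast, ← Real.rpow_mul (by positivity), one_div_mul_cancel hn'.ne',
      Real.rpow_one]
  have hRs : R ^ ((n : ℝ) + 2 * s) = (2 * e / w) ^ (1 + σ) := by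
    rw [hR, ← Real.rpow_mul (by positivity), hσ]
    congr 1
    field_simp
  have hball : volume (Metric.ball x R) = ENNReal.ofReal (2 * e) := by
    rw [Measure.addHaar_ball_of_pos _ _ hR0, finrank_euclideanSpace_fin, hRn,
      ← ENNReal.ofReal_toReal hw_top, ← hw, ← ENNReal.ofReal_mul (by positivity),
      div_mul_cancel₀ _ hw0.ne']
  have hdiff : ENNReal.ofReal e ≤ volume (Metric.ball x R ∩ Eᶜ) := by
    rw [← sdiff_eq]
    refine le_trans ?_ le_measure_sdiff
    rw [hball, hEe, ← ENNReal.ofReal_sub _ he0.le]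
    exact ENNReal.ofReal_le_ofReal (by linarith)
  have hint : ENNReal.ofReal (1 / R ^ ((n : ℝ) + 2 * s)) * ENNReal.ofReal e ≤
      ∫⁻ y in Eᶜ, ENNReal.ofReal (1 / ‖x - y‖ ^ ((n : ℝ) + 2 * s)) := by
    -- the centre is removed because the kernel takes the junk value `1 / 0 = 0` there
    have hmeas : MeasurableSet (Metric.ball x R \ {x}) :=
      Metric.isOpen_ball.measurableSet.diff (measurableSet_singleton x)
    calc _ ≤ ENNReal.ofReal (1 / R ^ ((n : ℝ) + 2 * s)) * volume (Metric.ball x R ∩ Eᶜ) := by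
          gcongr
      _ = ∫⁻ y in Eᶜ, (Metric.ball x R \ {x}).indicator
            (fun _ => ENNReal.ofReal (1 / R ^ ((n : ℝ) + 2 * s))) y := by
          rw [lintegral_indicator_const hmeas, Measure.restrict_apply hmeas]
          congr 2
          ext y
          simp only [mem_inter_iff, mem_compl_iff, Set.mem_sdiff, mem_singleton_iff]
          constructor
          · rintro ⟨h1, h2⟩
            exact ⟨⟨h1, fun h => h2 (h ▸ hxE)⟩, h2⟩
          · rintro ⟨⟨h1, -⟩, h2⟩
            exact ⟨h1, h2⟩
      _ ≤ _ := by
          refine lintegral_mono fun y => ?_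
          refine indicator_le
            (g := fun z => ENNReal.ofReal (1 / ‖x - z‖ ^ ((n : ℝ) + 2 * s))) (fun z hz => ?_) y
          have h1 : 0 < ‖x - z‖ := norm_pos_iff.2 (sub_ne_zero.2 fun h => hz.2 h.symm)
          have h2 : ‖x - z‖ ≤ R := by
            rw [← dist_eq_norm, dist_comm]; exact (Metric.mem_ball.1 hz.1).le
          refine ENNReal.ofReal_le_ofReal (one_div_le_one_div_of_le (by positivity) ?_)
          gcongr
  refine le_trans (le_of_eq ?_) (mul_le_mul_right hint _)
  rw [hRs, hEe, ENNReal.ofReal_rpow_of_pos he0, ← ENNReal.ofReal_coe_nnreal,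
    Real.coe_toNNReal _ (by positivity), ← ENNReal.ofReal_mul (by positivity),
    ← ENNReal.ofReal_mul (by positivity), ← ENNReal.ofReal_mul (by positivity),
    ← ENNReal.ofReal_one]
  congr 1
  have : (2 * e / w) ^ (1 + σ) = (2 / w) ^ (1 + σ) * (e * e ^ σ) := by
    rw [mul_div_right_comm, Real.mul_rpow (by positivity) he0.le, Real.rpow_add he0, Real.rpow_one]
  rw [this]
  field_simp

/-- The part of `t` between the levels `k` and `l`. -/
def levelSlice (k l t : ℝ) : ℝ := min (max (t - k) 0) (l - k)

lemma levelSlice_sub_mem (k l : ℝ) {a b : ℝ} (hba : b ≤ a) :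
    0 ≤ levelSlice k l a - levelSlice k l b ∧
      levelSlice k l a - levelSlice k l b ≤ a - b := by
  unfold levelSlice
  constructor <;> grind

lemma sq_levelSlice_sub_le (k l a b : ℝ) :
    |levelSlice k l a - levelSlice k l b| ^ 2 ≤
      (a - b) * (levelSlice k l a - levelSlice k l b) := by
  rw [sq_abs]
  rcases le_total b a with h | h
  · obtain ⟨h1, h2⟩ := levelSlice_sub_mem k l h
    nlinarith
  · obtain ⟨h1, h2⟩ := levelSlice_sub_mem k l h
    nlinarith

lemma mul_levelSlice_sub_le (k l a b : ℝ) :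
    (a - b) * (levelSlice k l a - levelSlice k l b) ≤ |a - b| ^ 2 := by
  rw [sq_abs]
  rcases le_total b a with h | h
  · obtain ⟨h1, h2⟩ := levelSlice_sub_mem k l h
    nlinarith
  · obtain ⟨h1, h2⟩ := levelSlice_sub_mem k l h
    nlinarith

lemma levelSlice_of_le {k l t : ℝ} (hkl : k < l) (ht : t ≤ k) : levelSlice k l t = 0 := by
  unfold levelSlice; grind

lemma levelSlice_of_lt {k l t : ℝ} (hkl : k < l) (ht : l < t) : levelSlice k l t = l - k := by
  unfold levelSlice; grind

lemma levelSlice_nonneg {k l : ℝ} (hkl : k < l) (t : ℝ) : 0 ≤ levelSlice k l t := by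
  unfold levelSlice; grind

lemma levelSlice_le (k l t : ℝ) : levelSlice k l t ≤ l - k := min_le_right _ _

lemma levelSlice_le_abs {k l : ℝ} (hk : 0 ≤ k) (t : ℝ) : levelSlice k l t ≤ |t| :=
  (min_le_left _ _).trans (max_le (by linarith [le_abs_self t]) (abs_nonneg t))

lemma continuous_levelSlice (k l : ℝ) : Continuous (levelSlice k l) := by
  unfold levelSlice; fun_prop

/-- The Gagliardo energy of the slice of `u` between two levels controls the measure of the upper
superlevel set (a Faber–Krahn type inequality): only the interaction of `{u > l}` with the
complement of `{u > k}` is needed. -/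
lemma exists_measure_superlevel_le_gagliardoSq (hn : 0 < n) (hs : 0 < s) :
    ∃ B : ℝ≥0, ∀ (u : EuclideanSpace ℝ (Fin n) → ℝ) (k l : ℝ), AEStronglyMeasurable u volume →
      k < l → volume {x | k < u x} ≠ ∞ →
      ENNReal.ofReal ((l - k) ^ 2) * volume {x | l < u x} ≤
        B * volume {x | k < u x} ^ (2 * s / n) * gagliardoSq s (fun x => levelSlice k l (u x)) := by
  obtain ⟨B, hB⟩ := exists_one_le_mul_lintegral_compl hn hs
  refine ⟨B, fun u k l hu hkl hfin => ?_⟩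
  have hsub : {x | l < u x} ⊆ {x | k < u x} := fun x hx => hkl.trans hx
  rcases eq_or_ne (volume {x | k < u x}) 0 with h0 | h0
  · rw [measure_mono_null hsub h0, mul_zero]
    exact zero_le
  set c : ℝ≥0∞ := B * volume {x | k < u x} ^ (2 * s / n) with hc
  have hmk := nullMeasurableSet_superlevel hu.aemeasurable k
  have hml := nullMeasurableSet_superlevel hu.aemeasurable l
  set T : EuclideanSpace ℝ (Fin n) → ℝ := fun x => levelSlice k l (u x) with hT
  have hTm : AEStronglyMeasurable T volume :=
    (continuous_levelSlice k l).comp_aestronglyMeasurable hu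
  have hmeas : AEMeasurable (fun p : EuclideanSpace ℝ (Fin n) × EuclideanSpace ℝ (Fin n) =>
      ENNReal.ofReal (|T p.1 - T p.2| ^ 2 / ‖p.1 - p.2‖ ^ ((n : ℝ) + 2 * s)))
      (volume.prod volume) := by
    have h1 : AEMeasurable (fun p : EuclideanSpace ℝ (Fin n) × EuclideanSpace ℝ (Fin n) =>
        T p.1 - T p.2) (volume.prod volume) := hTm.aemeasurable.comp_fst.sub hTm.aemeasurable.comp_snd
    have h2 : Measurable (fun p : EuclideanSpace ℝ (Fin n) × EuclideanSpace ℝ (Fin n) =>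
        ‖p.1 - p.2‖ ^ ((n : ℝ) + 2 * s)) := by fun_prop
    simp_rw [sq_abs]
    exact ((h1.pow_const 2).div h2.aemeasurable).ennreal_ofReal
  have hinner : ∀ x ∈ {x | l < u x}, ENNReal.ofReal ((l - k) ^ 2) ≤
      c * ∫⁻ y, ENNReal.ofReal (|T x - T y| ^ 2 / ‖x - y‖ ^ ((n : ℝ) + 2 * s)) := by
    intro x hx
    calc ENNReal.ofReal ((l - k) ^ 2) = ENNReal.ofReal ((l - k) ^ 2) * 1 := (mul_one _).symm
      _ ≤ ENNReal.ofReal ((l - k) ^ 2) * (c *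
            ∫⁻ y in {x | k < u x}ᶜ, ENNReal.ofReal (1 / ‖x - y‖ ^ ((n : ℝ) + 2 * s))) := by
          gcongr
          exact hB _ h0 hfin x (hsub hx)
      _ = c * ∫⁻ y in {x | k < u x}ᶜ, ENNReal.ofReal ((l - k) ^ 2) *
            ENNReal.ofReal (1 / ‖x - y‖ ^ ((n : ℝ) + 2 * s)) := by
          rw [lintegral_const_mul' _ _ ENNReal.ofReal_ne_top, mul_left_comm]
      _ ≤ c * ∫⁻ y in {x | k < u x}ᶜ,
            ENNReal.ofReal (|T x - T y| ^ 2 / ‖x - y‖ ^ ((n : ℝ) + 2 * s)) := by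
          gcongr c * ?_
          refine lintegral_mono_ae ?_
          filter_upwards [ae_restrict_mem₀ hmk.compl] with y hy
          have hy : u y ≤ k := not_lt.1 hy
          rw [← ENNReal.ofReal_mul (sq_nonneg _), mul_one_div]
          simp only [hT]
          rw [levelSlice_of_lt hkl hx, levelSlice_of_le hkl hy, sub_zero, sq_abs]
      _ ≤ _ := by
          gcongr c * ?_
          exact setLIntegral_le_lintegral _ _
  have hprod : gagliardoSq s T = ∫⁻ x, ∫⁻ y,
      ENNReal.ofReal (|T x - T y| ^ 2 / ‖x - y‖ ^ ((n : ℝ) + 2 * s)) := by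
    unfold gagliardoSq
    rw [Measure.volume_eq_prod, lintegral_prod _ hmeas]
  have hctop : c ≠ ∞ := ENNReal.mul_ne_top ENNReal.coe_ne_top
    (ENNReal.rpow_ne_top_of_nonneg (by positivity) hfin)
  calc ENNReal.ofReal ((l - k) ^ 2) * volume {x | l < u x}
      = ∫⁻ _ in {x | l < u x}, ENNReal.ofReal ((l - k) ^ 2) := by rw [setLIntegral_const]
    _ ≤ ∫⁻ x in {x | l < u x}, c * ∫⁻ y,
          ENNReal.ofReal (|T x - T y| ^ 2 / ‖x - y‖ ^ ((n : ℝ) + 2 * s)) := by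
        refine lintegral_mono_ae ?_
        filter_upwards [ae_restrict_mem₀ hml] with x hx using hinner x hx
    _ ≤ ∫⁻ x, c * ∫⁻ y, ENNReal.ofReal (|T x - T y| ^ 2 / ‖x - y‖ ^ ((n : ℝ) + 2 * s)) :=
        setLIntegral_le_lintegral _ _
    _ = c * gagliardoSq s T := by rw [lintegral_const_mul' _ _ hctop, hprod]

/-- Slices of functions of `Ḣ^s` are admissible test functions. -/
lemma MemHDot.memX_levelSlice {u : EuclideanSpace ℝ (Fin n) → ℝ} (hu : MemHDot s u) {k l : ℝ}
    (hk : 0 ≤ k) (hkl : k < l) : MemX s (fun x => levelSlice k l (u x)) := by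
  have hmeas : AEStronglyMeasurable (fun x => levelSlice k l (u x)) volume :=
    (continuous_levelSlice k l).comp_aestronglyMeasurable hu.memLp.aestronglyMeasurable
  refine ⟨⟨hu.memLp.mono hmeas (ae_of_all _ fun x => ?_), ?_⟩,
    memLp_top_of_bound hmeas (l - k) (ae_of_all _ fun x => ?_)⟩
  · rw [Real.norm_eq_abs, Real.norm_eq_abs, abs_of_nonneg (levelSlice_nonneg hkl _)]
    exact levelSlice_le_abs hk _
  · refine lt_of_le_of_lt (lintegral_mono fun p => ENNReal.ofReal_le_ofReal ?_)
      hu.gagliardoSq_lt_top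
    gcongr ?_ / _
    exact (sq_levelSlice_sub_le k l _ _).trans (mul_levelSlice_sub_le k l _ _)
  · rw [Real.norm_eq_abs, abs_of_nonneg (levelSlice_nonneg hkl _)]
    exact levelSlice_le k l _

/-- Testing the equation with a slice of the solution. -/
lemma IsWeakSolution.gagliardoSq_levelSlice_le {u F : EuclideanSpace ℝ (Fin n) → ℝ}
    (hu : IsWeakSolution s u F) {k l : ℝ} (hk : 0 ≤ k) (hkl : k < l) :
    gagliardoSq s (fun x => levelSlice k l (u x)) ≤
      ENNReal.ofReal (l - k) * ∫⁻ x in {x | k < u x}, ‖F x‖ₑ := by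
  have hum := hu.memHDot.memLp.aestronglyMeasurable
  have hX := hu.memHDot.memX_levelSlice hk hkl
  set T : EuclideanSpace ℝ (Fin n) → ℝ := fun x => levelSlice k l (u x) with hT
  have hTm : AEStronglyMeasurable T volume := hX.memLp_top.aestronglyMeasurable
  have hFT : ∫⁻ x, ‖F x * T x‖ₑ ≤ ENNReal.ofReal (l - k) * ∫⁻ x in {x | k < u x}, ‖F x‖ₑ := by
    rw [← lintegral_const_mul' _ _ ENNReal.ofReal_ne_top,
      ← lintegral_indicator₀ (nullMeasurableSet_superlevel hum.aemeasurable k)]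
    refine lintegral_mono fun x => ?_
    by_cases hx : k < u x
    · rw [indicator_of_mem (by exact hx), enorm_mul, mul_comm]
      gcongr
      rw [Real.enorm_eq_ofReal (levelSlice_nonneg hkl _)]
      exact ENNReal.ofReal_le_ofReal (levelSlice_le k l _)
    · simp [hT, levelSlice_of_le hkl (not_lt.1 hx)]
  -- if the right-hand side is infinite, the slice need not be admissible, but the claim is trivial
  rcases eq_or_ne (∫⁻ x in {x | k < u x}, ‖F x‖ₑ) ∞ with htop | htop
  · rw [htop, ENNReal.mul_top (by simpa using hkl)]
    exact le_top
  have hint : Integrable (fun x => F x * T x) volume :=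
    ⟨hu.aestronglyMeasurable.mul hTm,
      lt_of_le_of_lt hFT (ENNReal.mul_lt_top ENNReal.ofReal_lt_top htop.lt_top)⟩
  set g : EuclideanSpace ℝ (Fin n) × EuclideanSpace ℝ (Fin n) → ℝ := fun p =>
    (u p.1 - u p.2) * (T p.1 - T p.2) / ‖p.1 - p.2‖ ^ ((n : ℝ) + 2 * s) with hg
  have hg1 : ∀ p, |T p.1 - T p.2| ^ 2 / ‖p.1 - p.2‖ ^ ((n : ℝ) + 2 * s) ≤ g p := fun p =>
    div_le_div_of_nonneg_right (sq_levelSlice_sub_le k l _ _) (by positivity)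
  have hg0 : ∀ p, 0 ≤ g p := fun p => le_trans (by positivity) (hg1 p)
  have hg2 : ∀ p, g p ≤ |u p.1 - u p.2| ^ 2 / ‖p.1 - p.2‖ ^ ((n : ℝ) + 2 * s) := fun p =>
    div_le_div_of_nonneg_right (mul_levelSlice_sub_le k l _ _) (by positivity)
  have hgm : AEStronglyMeasurable g volume := by
    have h2 : Measurable (fun p : EuclideanSpace ℝ (Fin n) × EuclideanSpace ℝ (Fin n) =>
        ‖p.1 - p.2‖ ^ ((n : ℝ) + 2 * s)) := by fun_prop
    rw [Measure.volume_eq_prod]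
    exact (((hum.aemeasurable.comp_fst.sub hum.aemeasurable.comp_snd).mul
      (hTm.aemeasurable.comp_fst.sub hTm.aemeasurable.comp_snd)).div
      h2.aemeasurable).aestronglyMeasurable
  -- without integrability the Bochner integral defining the form would be `0`
  have hgi : Integrable g volume := by
    refine ⟨hgm, lt_of_le_of_lt (lintegral_mono fun p => ?_) hu.memHDot.gagliardoSq_lt_top⟩
    rw [Real.enorm_eq_ofReal (hg0 p)]
    exact ENNReal.ofReal_le_ofReal (hg2 p)
  calc gagliardoSq s T ≤ ∫⁻ p, ENNReal.ofReal (g p) :=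
        lintegral_mono fun p => ENNReal.ofReal_le_ofReal (hg1 p)
    _ = ENNReal.ofReal (gagliardoForm s u T) :=
        (ofReal_integral_eq_lintegral_ofReal hgi (ae_of_all _ hg0)).symm
    _ = ENNReal.ofReal (∫ x, F x * T x) := by rw [hu.weak_eq T hX hint]
    _ ≤ ‖∫ x, F x * T x‖ₑ := Real.ofReal_le_enorm _
    _ ≤ ∫⁻ x, ‖F x * T x‖ₑ := enorm_integral_le_lintegral_enorm _
    _ ≤ _ := hFT

lemma IsWeakSolution.neg {u F : EuclideanSpace ℝ (Fin n) → ℝ} (hu : IsWeakSolution s u F) :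
    IsWeakSolution s (fun x => -u x) (fun x => -F x) := by
  refine ⟨⟨hu.memHDot.memLp.neg, ?_⟩, hu.aestronglyMeasurable.neg, fun φ hφ hint => ?_⟩
  · refine lt_of_le_of_lt (le_of_eq ?_) hu.memHDot.gagliardoSq_lt_top
    unfold gagliardoSq
    refine lintegral_congr fun p => ?_
    rw [neg_sub_neg, abs_sub_comm]
  · have h1 := hu.weak_eq φ hφ (by simpa using hint.neg)
    simp only [neg_mul, integral_neg]
    rw [← h1]
    unfold gagliardoForm
    rw [← integral_neg]
    congr 1
    ext p
    ring

end Energy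

/-! ### Coefficients in Lebesgue spaces -/

section Coefficients

variable {α : Type*} [MeasurableSpace α] {μ : Measure α} {u h : α → ℝ}

/-- Hölder's inequality for a coefficient `h ∈ L^m`, written with `θ = 1 / m`; the convention
`1 / ∞ = 0` covers `m = ∞`. -/
lemma lintegral_mul_rpow_le_upperMoment (hu : AEMeasurable u μ) {m : ℝ≥0∞} (hh : MemLp h m μ)
    (hm1 : 1 < m) {γ k : ℝ} :
    ∫⁻ x in {x | k < u x}, ‖h x‖ₑ * ENNReal.ofReal (u x) ^ γ ∂μ ≤
      eLpNorm h m μ * upperMoment μ u (γ / (1 - m.toReal⁻¹)) k ^ (1 - m.toReal⁻¹) := by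
  rcases eq_or_ne m ∞ with rfl | hm
  · simp only [ENNReal.toReal_top, inv_zero, sub_zero, div_one, ENNReal.rpow_one]
    have hh' : ∀ᵐ x ∂μ.restrict {x | k < u x}, ‖h x‖ₑ ≤ eLpNorm h ∞ μ := by
      rw [eLpNorm_exponent_top]
      exact ae_restrict_of_ae (enorm_ae_le_eLpNormEssSup h μ)
    unfold upperMoment
    rw [← lintegral_const_mul' _ _ hh.2.ne]
    refine lintegral_mono_ae ?_
    filter_upwards [hh'] with x hx
    gcongr
  · have hmr : 1 < m.toReal := by
      rw [← ENNReal.toReal_one]; exact (ENNReal.toReal_lt_toReal ENNReal.one_ne_top hm).2 hm1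
    have hm0 : m ≠ 0 := (zero_lt_one.trans hm1).ne'
    have hlt : m.toReal⁻¹ < 1 := inv_lt_one_of_one_lt₀ hmr
    have hθ : 1 - m.toReal⁻¹ ≠ 0 := by linarith
    have hconj : m.toReal.HolderConjugate (1 - m.toReal⁻¹)⁻¹ := by
      rw [Real.holderConjugate_iff]
      refine ⟨hmr, ?_⟩
      rw [inv_inv]; ring
    have := ENNReal.lintegral_mul_le_Lp_mul_Lq (μ.restrict {x | k < u x}) hconj
      (f := fun x => ‖h x‖ₑ) (g := fun x => ENNReal.ofReal (u x) ^ γ)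
      hh.1.restrict.enorm ((hu.ennreal_ofReal.restrict).pow_const γ)
    simp only [Pi.mul_apply, one_div, inv_inv, ← ENNReal.rpow_mul] at this
    refine this.trans ?_
    rw [eLpNorm_eq_lintegral_rpow_enorm_toReal hm0 hm, one_div, upperMoment, div_eq_mul_inv γ]
    gcongr
    exact Measure.restrict_le_self

end Coefficients

/-! ### The level set inequality for weak solutions -/

section Solutions

variable {n : ℕ} {s : ℝ}

/-- In the subcritical range, `θ = 1 / m` satisfies `p θ + max γ 1 + 1 < p`, where `p` is the
critical exponent. Replacing `γ` by `max γ 1` merges the two cases of the threshold. -/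
lemma mul_inv_add_lt_critExp (hp : 2 < critExp n s) {γ : ℝ} (hγ : γ < critExp n s - 1)
    {m : ℝ≥0∞} (hm : ENNReal.ofReal (mLower n s γ) < m) :
    critExp n s * m.toReal⁻¹ + max γ 1 + 1 < critExp n s := by
  set p := critExp n s with hpdef
  have hgap : 0 < p - 1 - max γ 1 := by
    rcases max_cases γ 1 with h | h <;> rw [h.1] <;> linarith
  have hlow : mLower n s γ = p / (p - 1 - max γ 1) := by
    unfold mLower
    split_ifs with h
    · rw [max_eq_right h]; congr 1; ring
    · rw [max_eq_left (not_le.1 h).le]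
  rcases eq_or_ne m ∞ with rfl | hmt
  · simp only [ENNReal.toReal_top, inv_zero, mul_zero]
    linarith
  · have h1 : p / (p - 1 - max γ 1) < m.toReal := by
      rw [← hlow]; exact (ENNReal.ofReal_lt_iff_lt_toReal (by rw [hlow]; positivity) hmt).1 hm
    have hm0 : 0 < m.toReal := lt_trans (by positivity) h1
    have h2 : p * m.toReal⁻¹ < p - 1 - max γ 1 := by
      rw [← div_eq_mul_inv, div_lt_iff₀ hm0, mul_comm]
      rwa [div_lt_iff₀ hgap] at h1
    linarith

lemma upperMoment_le_eLpNorm_rpow {α : Type*} [MeasurableSpace α] {μ : Measure α} (u : α → ℝ)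
    {p : ℝ} (hp : 0 < p) (k : ℝ) :
    upperMoment μ u p k ≤ eLpNorm u (ENNReal.ofReal p) μ ^ p := by
  rw [eLpNorm_eq_lintegral_rpow_enorm_toReal (by simpa using hp) ENNReal.ofReal_ne_top,
    ENNReal.toReal_ofReal hp.le, ← ENNReal.rpow_mul, one_div_mul_cancel hp.ne', ENNReal.rpow_one]
  refine (setLIntegral_le_lintegral _ _).trans (lintegral_mono fun x => ?_)
  exact ENNReal.rpow_le_rpow (Real.ofReal_le_enorm _) hp.le

/-- Weak solutions obey the level set inequality. -/
lemma exists_levelDecay_of_isWeakSolution (hn0 : 0 < n) (hs0 : 0 < s)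
    (hp : 2 < critExp n s) :
    ∃ A : ℝ≥0, ∀ {K : ℕ} {γ : Fin K → ℝ} {m : Fin K → ℝ≥0∞} {H : Fin K → ℝ≥0}
      (_ : ∀ i, γ i < critExp n s - 1) (_ : ∀ i, ENNReal.ofReal (mLower n s (γ i)) < m i)
      {h : Fin K → EuclideanSpace ℝ (Fin n) → ℝ} {u F : EuclideanSpace ℝ (Fin n) → ℝ},
      (∀ i, MemLp (h i) (m i) volume) → (∀ i, eLpNorm (h i) (m i) volume = H i) →
      IsWeakSolution s u F → (∀ᵐ x, |F x| ≤ ∑ i, |h i x| * |u x| ^ γ i) →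
      LevelDecay volume u (2 * s / n) A (fun i => max (γ i) 1) (fun i => (m i).toReal⁻¹) H := by
  obtain ⟨A, hA⟩ := exists_measure_superlevel_le_gagliardoSq hn0 hs0
  refine ⟨A, fun {K γ m H} hγ hm {h u F} hh hH hu hF k l hk hkl => ?_⟩
  have hp0 : 0 < critExp n s := by linarith
  have hk0 : 0 < k := by linarith
  have hum := hu.memHDot.memLp.aestronglyMeasurable
  have hfin : volume {x | k < u x} ≠ ∞ := by
    rw [← upperMoment_zero]
    refine ((upperMoment_le_rpow_mul hum.aemeasurable hk hp0.le).trans_lt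
      (ENNReal.mul_lt_top ENNReal.ofReal_lt_top ?_)).ne
    exact (upperMoment_le_eLpNorm_rpow u hp0 1).trans_lt
      (ENNReal.rpow_lt_top_of_nonneg hp0.le hu.memHDot.memLp.2.ne)
  have hFint : ∫⁻ x in {x | k < u x}, ‖F x‖ₑ ≤ ∑ i, H i *
      upperMoment volume u (max (γ i) 1 / (1 - (m i).toReal⁻¹)) k ^ (1 - (m i).toReal⁻¹) := by
    calc ∫⁻ x in {x | k < u x}, ‖F x‖ₑ
        ≤ ∫⁻ x in {x | k < u x}, ∑ i, ‖h i x‖ₑ * ENNReal.ofReal (u x) ^ max (γ i) 1 := by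
          refine lintegral_mono_ae ?_
          filter_upwards [ae_restrict_of_ae hF,
            ae_restrict_mem₀ (nullMeasurableSet_superlevel hum.aemeasurable k)] with x hx hxk
          have hxk : k < u x := hxk
          have hux : 0 < u x := hk0.trans hxk
          have h1 : |F x| ≤ ∑ i, |h i x| * u x ^ max (γ i) 1 := by
            refine hx.trans (Finset.sum_le_sum fun i _ => ?_)
            rw [abs_of_pos hux]
            exact mul_le_mul_of_nonneg_left (Real.rpow_le_rpow_of_exponent_le
              (hk.trans hxk.le) (le_max_left _ _)) (abs_nonneg _)
          rw [Real.enorm_eq_ofReal_abs]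
          refine (ENNReal.ofReal_le_ofReal h1).trans (le_of_eq ?_)
          rw [ENNReal.ofReal_sum_of_nonneg fun i _ => by positivity]
          refine Finset.sum_congr rfl fun i _ => ?_
          rw [ENNReal.ofReal_mul (abs_nonneg _), ENNReal.ofReal_rpow_of_pos hux,
            Real.enorm_eq_ofReal_abs]
      _ = ∑ i, ∫⁻ x in {x | k < u x}, ‖h i x‖ₑ * ENNReal.ofReal (u x) ^ max (γ i) 1 := by
          refine lintegral_finsetSum' _ fun i _ => ?_
          exact (hh i).1.restrict.enorm.mul
            ((hum.aemeasurable.ennreal_ofReal.restrict).pow_const _)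
      _ ≤ _ := by
          refine Finset.sum_le_sum fun i _ => ?_
          rw [← hH i]
          refine lintegral_mul_rpow_le_upperMoment hum.aemeasurable (hh i) ?_
          refine lt_of_le_of_lt ?_ (hm i)
          rw [ENNReal.one_le_ofReal]
          unfold mLower
          have := hγ i
          split_ifs with h1
          · rw [one_le_div (by linarith)]; linarith
          · rw [one_le_div (by linarith)]; linarith
  have hlk : ENNReal.ofReal (l - k) ≠ 0 := by simpa using hkl
  rw [← ENNReal.mul_le_mul_iff_right hlk ENNReal.ofReal_ne_top]
  calc ENNReal.ofReal (l - k) * (ENNReal.ofReal (l - k) * volume {x | l < u x})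
      = ENNReal.ofReal ((l - k) ^ 2) * volume {x | l < u x} := by
        rw [← mul_assoc, ← ENNReal.ofReal_mul (by linarith), sq]
    _ ≤ A * volume {x | k < u x} ^ (2 * s / n) *
          gagliardoSq s (fun x => levelSlice k l (u x)) := hA u k l hum hkl hfin
    _ ≤ A * volume {x | k < u x} ^ (2 * s / n) * (ENNReal.ofReal (l - k) *
          ∑ i, H i * upperMoment volume u (max (γ i) 1 / (1 - (m i).toReal⁻¹)) k ^
            (1 - (m i).toReal⁻¹)) := by
        refine mul_le_mul_right ((hu.gagliardoSq_levelSlice_le hk0.le hkl).trans ?_) _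
        exact mul_le_mul_right hFint _
    _ = _ := by rw [mul_left_comm]

end Solutions

end FracElliptic

theorem theorem2p3 (n : ℕ) (s : ℝ) (hs0 : 0 < s) (hs1 : s < 1) (hn : 2 * s < (n : ℝ))
    (K : ℕ) (γ : Fin K → ℝ) (hγ : ∀ i, γ i ∈ Set.Ico (0 : ℝ) (FracElliptic.critExp n s - 1))
    (m : Fin K → ℝ≥0∞) (hm : ∀ i, ENNReal.ofReal (FracElliptic.mLower n s (γ i)) < m i)
    (U : ℝ≥0) (H : Fin K → ℝ≥0) :
    ∃ C : ℝ, 0 < C ∧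
      ∀ (f : EuclideanSpace ℝ (Fin n) → ℝ → ℝ)
        (f' : Fin K → EuclideanSpace ℝ (Fin n) → ℝ → ℝ)
        (h : Fin K → EuclideanSpace ℝ (Fin n) → ℝ)
        (u : EuclideanSpace ℝ (Fin n) → ℝ),
        (∀ i, MemLp (h i) (m i) volume) →
        (∀ i, ∀ᵐ x, 0 ≤ h i x) →
        (∀ᵐ x, ∀ r : ℝ, |f x r| ≤ ∑ i, f' i x r) →
        (∀ i, ∀ᵐ x, ∀ r : ℝ, f' i x r ≤ h i x * |r| ^ γ i) →
        FracElliptic.IsWeakSolution s u (fun x => f x (u x)) →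
        (∀ i, eLpNorm (h i) (m i) volume = H i) →
        eLpNorm u (ENNReal.ofReal (FracElliptic.critExp n s)) volume = U →
        eLpNorm u ∞ volume ≤ ENNReal.ofReal C := by
  open FracElliptic in
  have hn0 : (0 : ℝ) < n := by linarith
  have hd : 0 < (n : ℝ) - 2 * s := by linarith
  have hp2 : 2 < critExp n s := by
    unfold critExp
    rw [lt_div_iff₀ hd]
    linarith
  have hp0 : 0 < critExp n s := by linarith
  have hpσ : critExp n s * (2 * s / n) = critExp n s - 2 := by
    unfold critExp
    field_simp
    ring
  have hsub : ∀ i, critExp n s * (m i).toReal⁻¹ + max (γ i) 1 + 1 < critExp n s := fun i =>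
    mul_inv_add_lt_critExp hp2 (hγ i).2 (hm i)
  obtain ⟨A, hA⟩ := exists_levelDecay_of_isWeakSolution (n := n) (s := s)
    (by exact_mod_cast hn0) hs0 hp2
  obtain ⟨C, hC0, hC⟩ := LevelDecay.exists_forall_ae_le
    (volume : Measure (EuclideanSpace ℝ (Fin n))) A H (p := critExp n s) (σ := 2 * s / n)
    (γ := fun i => max (γ i) 1) (θ := fun i => (m i).toReal⁻¹) (by linarith) (by positivity)
    (by rw [div_le_one hn0]; exact hn.le)
    (fun i => by
      have h1 := hsub i
      have h2 := le_max_right (γ i) 1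
      refine lt_of_mul_lt_mul_left ?_ hp0.le
      linarith)
    (fun i => le_max_right _ _) (fun i => by linarith [hsub i])
    (fun i => by rw [mul_sub, hpσ]; linarith [hsub i])
    (U ^ critExp n s)
  refine ⟨C, hC0, fun f f' h u hh hh0 hf hf' hu hH hU => ?_⟩
  have hF : ∀ᵐ x, |f x (u x)| ≤ ∑ i, |h i x| * |u x| ^ γ i := by
    filter_upwards [hf, ae_all_iff.2 hf'] with x h1 h2
    refine (h1 (u x)).trans (Finset.sum_le_sum fun i _ => (h2 i (u x)).trans ?_)
    exact mul_le_mul_of_nonneg_right (le_abs_self _) (by positivity)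
  -- the one-sided bound applies to `u` and to `-u`
  have upper : ∀ v F : EuclideanSpace ℝ (Fin n) → ℝ, IsWeakSolution s v F →
      eLpNorm v (ENNReal.ofReal (critExp n s)) volume = U →
      (∀ᵐ x, |F x| ≤ ∑ i, |h i x| * |v x| ^ γ i) → ∀ᵐ x, v x ≤ C := fun v F hv hvU hvF =>
    hC v hv.memHDot.memLp.aestronglyMeasurable.aemeasurable
      (hA (fun i => (hγ i).2) hm hh hH hv hvF)
      ((upperMoment_le_eLpNorm_rpow v hp0 1).trans (le_of_eq (by
        rw [hvU, ENNReal.coe_rpow_of_nonneg _ hp0.le])))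
  have h1 := upper u _ hu hU hF
  have h2 := upper (fun x => -u x) _ hu.neg (by rw [← hU]; exact eLpNorm_neg u _ _)
    (by simpa only [abs_neg] using hF)
  rw [eLpNorm_exponent_top]
  refine eLpNormEssSup_le_of_ae_bound ?_
  filter_upwards [h1, h2] with x hx1 hx2
  rw [Real.norm_eq_abs, abs_le]
  constructor <;> linarith
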